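/- Let $\mathscr{C}_{\mathbb{Z}}$ be the extended bicyclic semigroup, that is, the set $\mathbb{Z}\times\mathbb{Z}$ with the operation $$(a,b)\cdot(c,d)=\begin{cases}(a-b+c,d), & b<c;\\ (a,d), & b=c;\\ (a,d+b-c), & b>c.\end{cases}$$ Let $S_3=\mathscr{C}_{\mathbb{Z}}\sqcup\mathbb{Z}$, with the operations of $\mathscr{C}_{\mathbb{Z}}$ and of the additive group $\mathbb{Z}$ extended by $(a,b)\cdot n=n\cdot(a,b)=n+b-a\in\mathbb{Z}$, and let $\tau_3$ be the topology on $S_3$ in which every point of $\mathscr{C}_{\mathbb{Z}}$ is isolated and every $k\in\mathbb{Z}$ has as a neighbourhood base the sets $U_n(k)$, $n=1,2,3,\dots$, where $U_n(k)=\{k\}\cup\{(a,a+k): a\in\mathbb{Z},\ a\ge n\}$ if $k\ge 0$ and $U_n(k)=\{k\}\cup\{(a-k,a): a\in\mathbb{Z},\ a\ge n\}$ if $k\le 0$. An inverse semigroup is a semigroup in which every $x$ has a unique $x^{-1}$ with $xx^{-1}x=x$ and $x^{-1}xx^{-1}=x^{-1}$; a topological inverse semigroup is an inverse semigroup with a topology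 for which multiplication (jointly) and inversion are continuous. A congruence is a group congruence if its quotient semigroup is a group. **Theorem.** Let $T$ be a Hausdorff locally compact topological inverse semigroup that contains $\mathscr{C}_{\mathbb{Z}}$ as a dense subsemigroup. Put $${\uparrow}\mathscr{C}_{\mathbb{Z}}=\mathscr{C}_{\mathbb{Z}}\cup\{x\in T\setminus\mathscr{C}_{\mathbb{Z}} : x\cdot y\in\mathscr{C}_{\mathbb{Z}}\text{ for some }y\in\mathscr{C}_{\mathbb{Z}}\},\qquad I=T\setminus{\uparrow}\mathscr{C}_{\mathbb{Z}},$$ and suppose that $I\neq\varnothing$. Then: (i) for every $n\in\mathbb{Z}$ the set ${\downarrow}(n,n)=\{f\in T: ff=f,\ f\cdot(n,n)=(n,n)\cdot f=f\}$ is a compact subsemilattice of $T$ (a non-empty compact set that is a commutative semigroup of idempotents); (ii) $I$ is a subsemigroup of $T$ which, with the subspace topology, is topologically isomorphic to the discrete additive group $\mathbb{Z}$; (iii) if $\overline{e}$ is the unit of $I$, then $(a,b)\mapsto(a,b)\cdot\overline{e}$ is a surjective homomorphism $\mathscr{C}_{\mathbb{Z}}\to I$ whose kernel congruence is the least group congruence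 on $\mathscr{C}_{\mathbb{Z}}$; that is, it is the natural homomorphism generated by the least group congruence; (iv) $\mathscr{C}_{\mathbb{Z}}\cup I$ is a subsemigroup of $T$ which, with the subspace topology, is topologically isomorphic to $(S_3,\tau_3)$. -/

import Mathlib

universe u

/-- An inverse semigroup: every `x` has exactly one `y` with `x y x = x` and `y x y = y`;
this `y` is written `x⁻¹`. -/
class InverseSemigroup (S : Type u) extends Semigroup S, Inv S where
  mul_inv_mul : ∀ x : S, x * x⁻¹ * x = x
  inv_mul_inv : ∀ x : S, x⁻¹ * x * x⁻¹ = x⁻¹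
  inv_unique : ∀ x y : S, x * y * x = x → y * x * y = y → y = x⁻¹

/-- The underlying set `ℤ × ℤ` of the extended bicyclic semigroup. -/
@[ext]
structure ExtBicyclic : Type where
  fst : ℤ
  snd : ℤ

namespace ExtBicyclic

/-- The operation of the extended bicyclic semigroup. -/
def mul (x y : ExtBicyclic) : ExtBicyclic :=
  if x.snd < y.fst then ⟨x.fst - x.snd + y.fst, y.snd⟩
  else if x.snd = y.fst then ⟨x.fst, y.snd⟩
  else ⟨x.fst, y.snd + x.snd - y.fst⟩

instance : Mul ExtBicyclic := ⟨mul⟩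

theorem mul_def (x y : ExtBicyclic) :
    x * y = if x.snd < y.fst then ⟨x.fst - x.snd + y.fst, y.snd⟩
      else if x.snd = y.fst then ⟨x.fst, y.snd⟩
      else ⟨x.fst, y.snd + x.snd - y.fst⟩ := rfl

theorem fst_mul (x y : ExtBicyclic) :
    (x * y).fst = x.fst + max 0 (y.fst - x.snd) := by
  rw [mul_def]
  split_ifs <;> simp only <;> omega

theorem snd_mul (x y : ExtBicyclic) :
    (x * y).snd = y.snd + max 0 (x.snd - y.fst) := by
  rw [mul_def]
  split_ifs <;> simp only <;> omega

instance : Semigroup ExtBicyclic where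
  mul_assoc x y z := by
    ext <;> simp only [fst_mul, snd_mul] <;> omega

end ExtBicyclic

/-- The underlying set of `S₃`: the disjoint union of the extended bicyclic semigroup
and the additive group `ℤ`. -/
inductive SThree : Type where
  | bic : ExtBicyclic → SThree
  | grp : ℤ → SThree

namespace SThree

/-- The operation of `S₃`: both parts keep their own operation, and
`(a, b) · n = n · (a, b) = n + b - a`. -/
def mul : SThree → SThree → SThree
  | bic x, bic y => bic (x * y)
  | bic x, grp n => grp (n + x.snd - x.fst)
  | grp n, bic x => grp (n + x.snd - x.fst)
  | grp m, grp n => grp (m + n)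

instance : Mul SThree := ⟨mul⟩

theorem bic_mul_bic (x y : ExtBicyclic) : bic x * bic y = bic (x * y) := rfl

theorem bic_mul_grp (x : ExtBicyclic) (n : ℤ) : bic x * grp n = grp (n + x.snd - x.fst) := rfl

theorem grp_mul_bic (n : ℤ) (x : ExtBicyclic) : grp n * bic x = grp (n + x.snd - x.fst) := rfl

theorem grp_mul_grp (m n : ℤ) : grp m * grp n = grp (m + n) := rfl

instance : Semigroup SThree where
  mul_assoc x y z := by
    rcases x with x | x <;> rcases y with y | y <;> rcases z with z | z <;>
      simp only [bic_mul_bic, bic_mul_grp, grp_mul_bic, grp_mul_grp, mul_assoc, grp.injEq,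
        ExtBicyclic.fst_mul, ExtBicyclic.snd_mul] <;> omega

/-- The basic neighbourhood `U_n(k)` of the point `k ∈ ℤ` of `S₃`. -/
def basicNhd (n : ℕ) (k : ℤ) : Set SThree :=
  if 0 ≤ k then {grp k} ∪ {x | ∃ a : ℤ, (n : ℤ) ≤ a ∧ x = bic ⟨a, a + k⟩}
  else {grp k} ∪ {x | ∃ a : ℤ, (n : ℤ) ≤ a ∧ x = bic ⟨a - k, a⟩}

/-- The topology `τ₃` on `S₃`: the points of the extended bicyclic semigroup are isolated, and
the sets `U_n(k)`, `n = 1, 2, 3, …`, form a base at `k ∈ ℤ`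
(see `isOpen_singleton_bic` and `hasBasis_nhds_grp`). -/
instance : TopologicalSpace SThree where
  IsOpen U := ∀ k : ℤ, grp k ∈ U → ∃ n : ℕ, 1 ≤ n ∧ basicNhd n k ⊆ U
  isOpen_univ _ _ := ⟨1, le_rfl, Set.subset_univ _⟩
  isOpen_inter U V hU hV k hk := by
    obtain ⟨m, hm, hmU⟩ := hU k hk.1
    obtain ⟨n, hn, hnV⟩ := hV k hk.2
    have anti : ∀ i : ℕ, i ≤ max m n → basicNhd (max m n) k ⊆ basicNhd i k := by
      intro i hi x hx
      have hi' : (i : ℤ) ≤ ((max m n : ℕ) : ℤ) := by exact_mod_cast hi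
      unfold basicNhd at hx ⊢
      split_ifs at hx ⊢ <;> rcases hx with hx | ⟨a, ha, hx⟩
      · exact Or.inl hx
      · exact Or.inr ⟨a, hi'.trans ha, hx⟩
      · exact Or.inl hx
      · exact Or.inr ⟨a, hi'.trans ha, hx⟩
    exact ⟨max m n, hm.trans (le_max_left _ _), Set.subset_inter
      ((anti m (le_max_left _ _)).trans hmU) ((anti n (le_max_right _ _)).trans hnV)⟩
  isOpen_sUnion 𝒰 h𝒰 k := by
    rintro ⟨U, hU, hk⟩
    obtain ⟨n, hn, hnU⟩ := h𝒰 U hU k hk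
    exact ⟨n, hn, hnU.trans (Set.subset_sUnion_of_mem hU)⟩

theorem isOpen_iff (U : Set SThree) :
    IsOpen U ↔ ∀ k : ℤ, grp k ∈ U → ∃ n : ℕ, 1 ≤ n ∧ basicNhd n k ⊆ U := Iff.rfl

theorem isOpen_singleton_bic (x : ExtBicyclic) : IsOpen ({bic x} : Set SThree) := by
  rw [isOpen_iff]
  intro k hk
  simp at hk

theorem grp_mem_basicNhd (n : ℕ) (k l : ℤ) : grp l ∈ basicNhd n k ↔ l = k := by
  unfold basicNhd
  split_ifs <;> simp

theorem hasBasis_nhds_grp (k : ℤ) :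
    (nhds (grp k)).HasBasis (fun n : ℕ => 1 ≤ n) (fun n => basicNhd n k) := by
  refine ⟨fun U => ?_⟩
  rw [mem_nhds_iff]
  constructor
  · rintro ⟨V, hVU, hV, hk⟩
    obtain ⟨n, hn, hnV⟩ := (isOpen_iff V).1 hV k hk
    exact ⟨n, hn, hnV.trans hVU⟩
  · rintro ⟨n, hn, hnU⟩
    refine ⟨basicNhd n k, hnU, ?_, (grp_mem_basicNhd n k k).2 rfl⟩
    rw [isOpen_iff]
    intro l hl
    obtain rfl := (grp_mem_basicNhd n k l).1 hl
    exact ⟨n, hn, subset_rfl⟩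

end SThree

/-- `↑C = C ∪ L_C`, where `L_C` is the set of all `x ∉ C` such that `x y ∈ C` for some
`y ∈ C`. -/
def upSet {T : Type u} [Mul T] (C : Set T) : Set T :=
  C ∪ {x | x ∉ C ∧ ∃ y ∈ C, x * y ∈ C}

/-- `↓e`: the idempotents `f` with `f ≤ e` in the natural partial order, that is,
`f e = e f = f`. -/
def idemDown {T : Type u} [Mul T] (e : T) : Set T :=
  {f | IsIdempotentElem f ∧ f * e = f ∧ e * f = f}

/-- A non-empty subset that is a commutative semigroup of idempotents under the operation
of the ambient semigroup. -/
structure IsSubsemilattice {T : Type u} [Mul T] (A : Set T) : Prop where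
  nonempty : A.Nonempty
  mul_mem : ∀ x ∈ A, ∀ y ∈ A, x * y ∈ A
  mul_comm : ∀ x ∈ A, ∀ y ∈ A, x * y = y * x
  idem : ∀ x ∈ A, IsIdempotentElem x

/-- A congruence is a group congruence if its quotient semigroup is a group. -/
def IsGroupCongruence {S : Type u} [Mul S] (c : Con S) : Prop :=
  ∃ (G : Type u) (_ : Group G), Nonempty (c.Quotient ≃* G)

open Filter Topology

namespace ExtBicyclic

/-! Write C for the image of the extended bicyclic semigroup. A point x of I is a limit, along an
ultrafilter, of elements (a, b) of C with b → +∞. Were b bounded above, multiplying by some (m, m)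
would either put x(m, m) in C, which the definition of I forbids, or make a sequence with one
coordinate fixed and the other tending to +∞ converge, which `not_tendsto_of_snd_const` and
`not_tendsto_of_fst_const` forbid. So x⁻¹x is a limit of idempotents (b, b) with b → +∞. Such limits
are unique (`limit_idem_unique`), and local compactness upgrades this to convergence of the whole
sequence, (n, n) → z.

The diagonals then converge too: (n, n + k) → g_k, where g_k is `limitPoint ι z k`. Passing to the
limit in products gives g_k g_l = g_{k+l} and (a, b) g_k = g_k (a, b) = g_{k+b-a}, that is, a
continuous homomorphism S₃ → T.

The main difficulty is that k ↦ g_k might be periodic or recurrent, as in a compact monothetic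
group. `eventually_limitPoint_notMem_atTop` excludes this: a compact set meets each row {n} × ℤ in a
set bounded above, and the last points of the rows inside a compact neighbourhood of z would
accumulate at a point that contradicts recurrence. Hence the g_k are distinct and form a discrete,
closed group. Every x in I is a limit of elements (a, b)z = g_{b-a}, so this group is I. -/

theorem mk_mul_mk (a b c d : ℤ) :
    (⟨a, b⟩ * ⟨c, d⟩ : ExtBicyclic) = ⟨a + max 0 (c - b), d + max 0 (b - c)⟩ := by
  ext
  · exact fst_mul _ _
  · exact snd_mul _ _

end ExtBicyclic

theorem Ultrafilter.int_trichotomy (U : Ultrafilter ℤ) :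
    (∃ k : ℤ, U = pure k) ∨ (U : Filter ℤ) ≤ atTop ∨ (U : Filter ℤ) ≤ atBot := by
  by_cases h1 : (U : Filter ℤ) ≤ atTop
  · exact Or.inr (Or.inl h1)
  by_cases h2 : (U : Filter ℤ) ≤ atBot
  · exact Or.inr (Or.inr h2)
  left
  have h1' : ∃ M : ℤ, Set.Ici M ∉ U := by
    by_contra! h
    exact h1 (le_iInf fun M => le_principal_iff.2 (h M))
  have h2' : ∃ M : ℤ, Set.Iic M ∉ U := by
    by_contra! h
    exact h2 (le_iInf fun M => le_principal_iff.2 (h M))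
  obtain ⟨M, hM⟩ := h1'
  obtain ⟨N, hN⟩ := h2'
  rw [← Ultrafilter.compl_mem_iff_notMem] at hM hN
  obtain ⟨x, -, hx⟩ := Ultrafilter.eq_pure_of_finite_mem
    ((Set.finite_Ioo N M).subset fun x hx => ⟨not_le.1 hx.2, not_le.1 hx.1⟩)
    (inter_mem hM hN)
  exact ⟨x, hx⟩

theorem exists_ultrafilter_of_frequently {X : Type*} {F : Filter X} {p : X → Prop}
    (h : ∃ᶠ x in F, p x) : ∃ U : Ultrafilter X, (U : Filter X) ≤ F ∧ {x | p x} ∈ U := by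
  have : (F ⊓ 𝓟 {x | p x}).NeBot := frequently_mem_iff_neBot.1 h
  have hU := Ultrafilter.of_le (F ⊓ 𝓟 {x | p x})
  exact ⟨_, hU.trans inf_le_left, le_principal_iff.1 (hU.trans inf_le_right)⟩

/-- An injective homomorphism that is a topological embedding identifies its range with
its source. -/
theorem MulHom.nonempty_srange_continuousMulEquiv {M : Type*} {N : Type*} [Mul M] [Mul N]
    [TopologicalSpace M] [TopologicalSpace N] (f : M →ₙ* N) (hf : IsEmbedding f) :
    Nonempty (f.srange ≃ₜ* M) := by
  let e : M ≃ₜ Set.range f := hf.toHomeomorph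
  refine ⟨ContinuousMulEquiv.symm (N := f.srange) ⟨⟨e.toEquiv, fun x y => ?_⟩,
    e.continuous, e.symm.continuous⟩⟩
  exact Subtype.ext (map_mul f x y)

/-! ### The copy of the extended bicyclic semigroup in T -/

section Embedding

variable {T : Type*} [InverseSemigroup T] (ι : ExtBicyclic →ₙ* T)

theorem inv_image (a b : ℤ) : (ι ⟨a, b⟩)⁻¹ = ι ⟨b, a⟩ := by
  symm
  apply InverseSemigroup.inv_unique <;>
    simp [← map_mul, ExtBicyclic.mk_mul_mk]

theorem image_mul_image (a b c d : ℤ) :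
    ι ⟨a, b⟩ * ι ⟨c, d⟩ = ι ⟨a + max 0 (c - b), d + max 0 (b - c)⟩ := by
  rw [← map_mul, ExtBicyclic.mk_mul_mk]

theorem IsIdempotentElem.inv_eq {f : T} (hf : IsIdempotentElem f) : f⁻¹ = f :=
  (InverseSemigroup.inv_unique f f (by rw [hf.eq, hf.eq]) (by rw [hf.eq, hf.eq])).symm

variable {ι} in
theorem image_inj (hι : Function.Injective ι) {a b c d : ℤ} :
    ι ⟨a, b⟩ = ι ⟨c, d⟩ ↔ a = c ∧ b = d := by
  rw [hι.eq_iff, ExtBicyclic.mk.injEq]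

theorem image_mul_eq_of_eq {a b c d p q : ℤ} (h1 : a + max 0 (c - b) = p)
    (h2 : d + max 0 (b - c) = q) : ι ⟨a, b⟩ * ι ⟨c, d⟩ = ι ⟨p, q⟩ := by
  rw [image_mul_image, h1, h2]

variable [TopologicalSpace T] [T2Space T]

variable {ι} in
/-- The points of the extended bicyclic semigroup are isolated in every Hausdorff
semigroup in which it is dense. -/
theorem isOpen_singleton_image [ContinuousMul T] (hι : Function.Injective ι)
    (hdense : DenseRange ι) (x : ExtBicyclic) : IsOpen ({ι x} : Set T) := by
  obtain ⟨n, m⟩ := x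
  -- At a point (a, b) of C the first two conditions say a ≤ n and b ≤ m. Given these, the next two
  -- say b - a ≤ m - n and a - b ≤ n - m, and the last excludes a < n on that diagonal.
  let W : Set T := {x | ι ⟨n + 1, n + 1⟩ * x ≠ x ∧ x * ι ⟨m + 1, m + 1⟩ ≠ x ∧
    ι ⟨n + 1, n + 1⟩ * x * ι ⟨m + 2, m + 2⟩ ≠ ι ⟨n + 1, n + 1⟩ * x ∧
    ι ⟨n + 2, n + 2⟩ * (x * ι ⟨m + 1, m + 1⟩) ≠ x * ι ⟨m + 1, m + 1⟩ ∧
    ι ⟨n - 1, n - 1⟩ * x ≠ ι ⟨n - 1, m - 1⟩}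
  have hW : IsOpen W := by
    refine IsOpen.inter (isOpen_ne_fun (by fun_prop) (by fun_prop)) <|
      IsOpen.inter (isOpen_ne_fun (by fun_prop) (by fun_prop)) <|
      IsOpen.inter (isOpen_ne_fun (by fun_prop) (by fun_prop)) <|
      IsOpen.inter (isOpen_ne_fun (by fun_prop) (by fun_prop)) <|
      isOpen_ne_fun (by fun_prop) (by fun_prop)
  have hWC : W ∩ Set.range ι ⊆ {ι ⟨n, m⟩} := by
    rintro _ ⟨⟨h1, h2, h3, h4, h5⟩, ⟨⟨a, b⟩, rfl⟩⟩
    simp only [image_mul_image, ne_eq, image_inj hι] at h1 h2 h3 h4 h5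
    rw [Set.mem_singleton_iff, image_inj hι]
    omega
  have hmem : ι ⟨n, m⟩ ∈ W := by
    simp only [W, Set.mem_ofPred_eq, image_mul_image, ne_eq, image_inj hι]
    omega
  have : W = {ι ⟨n, m⟩} := by
    refine Set.Subset.antisymm (fun x hx => ?_) (Set.singleton_subset_iff.2 hmem)
    have := hdense.open_subset_closure_inter hW hx
    simpa using closure_mono hWC this
  exact this ▸ hW

/-! ### Limits at infinity and convergence of the idempotents -/

section Limits

variable [ContinuousMul T]

theorem limit_idem_mul {F : Filter ℤ} [F.NeBot] (hF : F ≤ atTop) {f : T}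
    (hf : Tendsto (fun n : ℤ => ι ⟨n, n⟩) F (𝓝 f)) (k : ℤ) :
    f * ι ⟨k, k⟩ = f ∧ ι ⟨k, k⟩ * f = f := by
  have hk : ∀ᶠ n in F, k ≤ n := hF (eventually_ge_atTop k)
  constructor
  · refine tendsto_nhds_unique ((hf.mul_const (ι ⟨k, k⟩)).congr' ?_) hf
    filter_upwards [hk] with n hn
    exact image_mul_eq_of_eq ι (by omega) (by omega)
  · refine tendsto_nhds_unique ((hf.const_mul (ι ⟨k, k⟩)).congr' ?_) hf
    filter_upwards [hk] with n hn
    exact image_mul_eq_of_eq ι (by omega) (by omega)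

/-- Each limit absorbs every (k, k), so fg equals f when g is approximated and g when f is. -/
theorem limit_idem_unique {F G : Filter ℤ} [F.NeBot] [G.NeBot] (hF : F ≤ atTop)
    (hG : G ≤ atTop) {f g : T} (hf : Tendsto (fun n : ℤ => ι ⟨n, n⟩) F (𝓝 f))
    (hg : Tendsto (fun n : ℤ => ι ⟨n, n⟩) G (𝓝 g)) : f = g := by
  have h1 : f * g = f := tendsto_nhds_unique (hg.const_mul f)
    (tendsto_const_nhds.congr fun k => ((limit_idem_mul ι hF hf k).1).symm)
  have h2 : f * g = g := tendsto_nhds_unique (hf.mul_const g)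
    (tendsto_const_nhds.congr fun k => ((limit_idem_mul ι hG hg k).2).symm)
  exact h1.symm.trans h2

variable [ContinuousInv T]

variable {ι} in
/-- The points `(j, m)` with `m` fixed do not accumulate as `j` tends to `+∞`. -/
theorem not_tendsto_of_snd_const (hι : Function.Injective ι) {X : Type*} {F : Filter X} [F.NeBot]
    {j : X → ℤ} (hj : Tendsto j F atTop) (m : ℤ) (y : T) :
    ¬ Tendsto (fun x => ι ⟨j x, m⟩) F (𝓝 y) := by
  intro hy
  have hy' : Tendsto (fun x => ι ⟨m, j x⟩) F (𝓝 y⁻¹) := by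
    simpa only [inv_image] using hy.inv
  have h1 : Tendsto (fun x => ι ⟨j x, j x⟩) F (𝓝 (y * y⁻¹)) :=
    (hy.mul hy').congr fun x => image_mul_eq_of_eq ι (by omega) (by omega)
  have h2 : Tendsto (fun x => ι ⟨j x + 1, j x + 1⟩) F
      (𝓝 (y * ι ⟨m + 1, m + 1⟩ * y⁻¹)) :=
    ((hy.mul_const _).mul hy').congr fun x => by
      rw [image_mul_image]
      exact image_mul_eq_of_eq ι (by omega) (by omega)
  have h3 : y⁻¹ * y = ι ⟨m, m⟩ :=
    tendsto_nhds_unique (hy'.mul hy) (tendsto_const_nhds.congr fun x =>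
      (image_mul_eq_of_eq ι (by omega) (by omega)).symm)
  -- Both sides are limits of idempotents (i, i) with i → +∞. Conjugating back by y would identify
  -- (m, m) with (m + 1, m + 1).
  have h4 : y * y⁻¹ = y * ι ⟨m + 1, m + 1⟩ * y⁻¹ :=
    limit_idem_unique ι (F := F.map j) (G := F.map fun x => j x + 1) hj
      (tendsto_atTop_add_const_right _ _ hj) (tendsto_map'_iff.2 h1) (tendsto_map'_iff.2 h2)
  have h5 : y⁻¹ * y * (y⁻¹ * y) = y⁻¹ * y * ι ⟨m + 1, m + 1⟩ * (y⁻¹ * y) := by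
    have := congrArg (fun t => y⁻¹ * t * y) h4
    simpa only [mul_assoc] using this
  rw [h3] at h5
  simp only [image_mul_image, image_inj hι] at h5
  omega

variable {ι} in
theorem not_tendsto_of_fst_const (hι : Function.Injective ι) {X : Type*} {F : Filter X} [F.NeBot]
    {j : X → ℤ} (hj : Tendsto j F atTop) (m : ℤ) (y : T) :
    ¬ Tendsto (fun x => ι ⟨m, j x⟩) F (𝓝 y) := fun hy =>
  not_tendsto_of_snd_const hι hj m y⁻¹ (by simpa only [inv_image] using hy.inv)

variable {ι} in
theorem eventually_notMem_of_isCompact (hι : Function.Injective ι) {K : Set T}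
    (hK : IsCompact K) (n : ℤ) : ∀ᶠ k : ℤ in atTop, ι ⟨n, k⟩ ∉ K := by
  by_contra h
  rw [not_eventually] at h
  simp only [not_not] at h
  obtain ⟨U, hU⟩ := exists_ultrafilter_of_frequently h
  obtain ⟨y, -, hy⟩ := hK.ultrafilter_le_nhds (U.map fun k => ι ⟨n, k⟩)
    (le_principal_iff.2 hU.2)
  exact not_tendsto_of_fst_const (F := (U : Filter ℤ)) hι (j := id) hU.1 n y hy

variable {ι} in
theorem exists_ultrafilter_of_mem_compl_upSet (hι : Function.Injective ι)
    (hdense : DenseRange ι) {x : T} (hx : x ∈ (upSet (Set.range ι))ᶜ) :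
    ∃ U : Ultrafilter ExtBicyclic, Tendsto ι U (𝓝 x) ∧
      Tendsto ExtBicyclic.snd U atTop := by
  have hne : (comap ι (𝓝 x)).NeBot := by
    rw [comap_neBot_iff]
    intro t ht
    obtain ⟨_, hs, ⟨c, rfl⟩⟩ := mem_closure_iff_nhds.1 (hdense x) t ht
    exact ⟨c, hs⟩
  have hxC : x ∉ Set.range ι := fun h => hx (Or.inl h)
  have hxm : ∀ m k : ℤ, x * ι ⟨m, m⟩ ≠ ι ⟨k, m⟩ := fun m k h =>
    hx (Or.inr ⟨hxC, _, ⟨_, rfl⟩, ⟨_, h.symm⟩⟩)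
  let U := Ultrafilter.of (comap ι (𝓝 x))
  have hU : Tendsto ι U (𝓝 x) := tendsto_iff_comap.2 (Ultrafilter.of_le _)
  refine ⟨U, hU, ?_⟩
  by_contra hsnd
  have hb : ∃ m : ℤ, ∀ᶠ c in (U : Filter ExtBicyclic), c.snd ≤ m := by
    rw [tendsto_atTop] at hsnd
    push Not at hsnd
    obtain ⟨m, hm⟩ := hsnd
    refine ⟨m, ?_⟩
    filter_upwards [hm] with c hc using hc.le
  obtain ⟨m, hm⟩ := hb
  have h1 : Tendsto (fun c : ExtBicyclic => ι ⟨c.fst - c.snd + m, m⟩) U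
      (𝓝 (x * ι ⟨m, m⟩)) := by
    refine (hU.mul_const _).congr' ?_
    filter_upwards [hm] with c hc
    exact image_mul_eq_of_eq ι (by omega) (by omega)
  -- A constant difference a - b puts x(m, m) in C. If it tends to +∞, the right products by (m, m)
  -- give the contradiction; if to -∞, the left products do.
  rcases (U.map fun c => c.fst - c.snd).int_trichotomy with ⟨k, hk⟩ | h | h
  · have hk' : ∀ᶠ c in (U : Filter ExtBicyclic), c.fst - c.snd = k := by
      have : {k} ∈ (U.map fun c => c.fst - c.snd) := by rw [hk]; exact Set.mem_singleton k
      exact this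
    refine hxm m (k + m) (tendsto_nhds_unique h1 (tendsto_const_nhds.congr' ?_))
    filter_upwards [hk'] with c hc
    rw [hc]
  · exact not_tendsto_of_snd_const hι (tendsto_atTop_add_const_right _ m h) m _ h1
  · have hle : ∀ᶠ c in (U : Filter ExtBicyclic), c.fst - c.snd ≤ 0 := h (eventually_le_atBot 0)
    have h2 : Tendsto (fun c : ExtBicyclic => ι ⟨m, -(c.fst - c.snd) + m⟩) U
        (𝓝 (ι ⟨m, m⟩ * x)) := by
      refine (hU.const_mul _).congr' ?_
      filter_upwards [hm, hle] with c hc hc'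
      exact image_mul_eq_of_eq ι (by omega) (by omega)
    exact not_tendsto_of_fst_const hι
      (tendsto_atTop_add_const_right _ m (tendsto_neg_atBot_atTop.comp h)) m _ h2

variable {ι} in
theorem exists_tendsto_idem [LocallyCompactSpace T] (hι : Function.Injective ι)
    (hdense : DenseRange ι) (hI : ((upSet (Set.range ι))ᶜ).Nonempty) :
    ∃ z : T, Tendsto (fun n : ℤ => ι ⟨n, n⟩) atTop (𝓝 z) := by
  obtain ⟨x, hx⟩ := hI
  obtain ⟨U, hU, hsnd⟩ := exists_ultrafilter_of_mem_compl_upSet hι hdense hx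
  have hz : Tendsto (fun n : ℤ => ι ⟨n, n⟩) (map ExtBicyclic.snd U) (𝓝 (x⁻¹ * x)) :=
    tendsto_map'_iff.2 <| (hU.inv.mul hU).congr fun c => by
      rw [inv_image]
      exact image_mul_eq_of_eq ι (by omega) (by omega)
  refine ⟨x⁻¹ * x, (compact_basis_nhds _).tendsto_right_iff.2 ?_⟩
  rintro K ⟨hKz, hK⟩
  by_contra hnot
  rw [not_eventually] at hnot
  have hfreq : ∃ᶠ n : ℤ in atTop, ι ⟨n, n⟩ ∈ K :=
    (hz.eventually_mem hKz).frequently.filter_mono hsnd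
  -- Exit times from K. Along them the idempotents still tend to x⁻¹x; multiplying by (1, 0) on the
  -- left and (0, 1) on the right shifts (k, k) to (k + 1, k + 1), so the successors outside K
  -- converge, again to x⁻¹x.
  have hstep : ∃ᶠ n : ℤ in atTop, ι ⟨n, n⟩ ∈ K ∧ ι ⟨n + 1, n + 1⟩ ∉ K := by
    rw [frequently_atTop] at hnot hfreq ⊢
    intro M
    by_contra! hcon
    obtain ⟨n, hn, hnK⟩ := hfreq M
    obtain ⟨p, hp, hpK⟩ := hnot n
    exact hpK (Int.leInduction (motive := fun p _ => ι ⟨p, p⟩ ∈ K) hnK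
      (fun q hq hqK => hcon q (hn.trans hq) hqK) p hp)
  obtain ⟨V, hV⟩ := exists_ultrafilter_of_frequently hstep
  obtain ⟨f, -, hf⟩ := hK.ultrafilter_le_nhds (V.map fun k => ι ⟨k, k⟩)
    (le_principal_iff.2 (Ultrafilter.mem_map.2 (mem_of_superset hV.2 fun n hn => hn.1)))
  have hf' : Tendsto (fun k : ℤ => ι ⟨k, k⟩) V (𝓝 f) := hf
  obtain rfl : f = x⁻¹ * x := limit_idem_unique ι hV.1 hsnd hf' hz
  have h1 : Tendsto (fun k : ℤ => ι ⟨k + 1, k + 1⟩) V (𝓝 (ι ⟨1, 0⟩ * (x⁻¹ * x) * ι ⟨0, 1⟩)) := by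
    refine ((hf'.const_mul _).mul_const _).congr' ?_
    filter_upwards [hV.1 (eventually_ge_atTop 0)] with k hk
    rw [image_mul_image]
    exact image_mul_eq_of_eq ι (by omega) (by omega)
  have h2 := limit_idem_unique ι
    (G := (V : Filter ℤ).map (· + 1)) hV.1
    (tendsto_atTop_add_const_right _ _ hV.1) hf' (tendsto_map'_iff.2 h1)
  rw [← h2] at h1
  obtain ⟨n, hn1, hn2⟩ := ((h1.eventually_mem hKz).and hV.2).exists
  exact hn2.2 hn1

end Limits

/-- The candidate for the `k`-th element of the group at infinity: `z` is meant to be the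
limit of the idempotents `(n, n)` as `n` tends to `+∞`. -/
def limitPoint {T : Type*} [InverseSemigroup T] (ι : ExtBicyclic →ₙ* T) (z : T) (k : ℤ) : T :=
  ι ⟨0, k⟩ * z

/-! ### The group of limits of the diagonals -/

section GroupPart

variable {ι} [ContinuousMul T] {z : T}

omit [T2Space T] in
theorem tendsto_image_mul
    (hz : Tendsto (fun n : ℤ => ι ⟨n, n⟩) atTop (𝓝 z)) (a b : ℤ) :
    Tendsto (fun n : ℤ => ι ⟨n, n + (b - a)⟩) atTop (𝓝 (ι ⟨a, b⟩ * z)) := by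
  have h : Tendsto (fun n : ℤ => n + (b - a)) atTop atTop :=
    tendsto_atTop_add_const_right _ _ tendsto_id
  refine ((hz.comp h).const_mul (ι ⟨a, b⟩)).congr' ?_
  filter_upwards [eventually_ge_atTop a] with n hn
  exact image_mul_eq_of_eq ι (by simp only; omega) (by simp only; omega)

theorem image_mul_limit (hz : Tendsto (fun n : ℤ => ι ⟨n, n⟩) atTop (𝓝 z)) (a b : ℤ) :
    ι ⟨a, b⟩ * z = limitPoint ι z (b - a) :=
  tendsto_nhds_unique (tendsto_image_mul hz a b)
    (by simpa only [sub_zero, limitPoint] using tendsto_image_mul hz 0 (b - a))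

omit [T2Space T] in
theorem tendsto_limitPoint (hz : Tendsto (fun n : ℤ => ι ⟨n, n⟩) atTop (𝓝 z)) (k : ℤ) :
    Tendsto (fun n : ℤ => ι ⟨n, n + k⟩) atTop (𝓝 (limitPoint ι z k)) := by
  simpa only [sub_zero, limitPoint] using tendsto_image_mul hz 0 k

theorem limitPoint_zero (hz : Tendsto (fun n : ℤ => ι ⟨n, n⟩) atTop (𝓝 z)) :
    limitPoint ι z 0 = z :=
  (limit_idem_mul ι le_rfl hz 0).2

theorem limitPoint_mul_limitPoint (hz : Tendsto (fun n : ℤ => ι ⟨n, n⟩) atTop (𝓝 z))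
    (k l : ℤ) : limitPoint ι z k * limitPoint ι z l = limitPoint ι z (k + l) := by
  refine tendsto_nhds_unique (((tendsto_limitPoint hz k).mul
    ((tendsto_limitPoint hz l).comp (tendsto_atTop_add_const_right _ k tendsto_id))).congr
      fun n => ?_) (tendsto_limitPoint hz (k + l))
  exact image_mul_eq_of_eq ι (by simp) (by simp; ring)

theorem mul_limit_limit (hz : Tendsto (fun n : ℤ => ι ⟨n, n⟩) atTop (𝓝 z)) : z * z = z := by
  simpa [limitPoint_zero hz] using limitPoint_mul_limitPoint hz 0 0

theorem image_mul_limitPoint (hz : Tendsto (fun n : ℤ => ι ⟨n, n⟩) atTop (𝓝 z))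
    (a b k : ℤ) : ι ⟨a, b⟩ * limitPoint ι z k = limitPoint ι z (k + b - a) := by
  rw [limitPoint, ← mul_assoc, image_mul_image, image_mul_limit hz]
  congr 1
  omega

theorem limitPoint_mul_image (hz : Tendsto (fun n : ℤ => ι ⟨n, n⟩) atTop (𝓝 z))
    (a b k : ℤ) : limitPoint ι z k * ι ⟨a, b⟩ = limitPoint ι z (k + b - a) := by
  refine tendsto_nhds_unique (((tendsto_limitPoint hz k).mul_const (ι ⟨a, b⟩)).congr' ?_)
    (tendsto_limitPoint hz (k + b - a))
  filter_upwards [eventually_ge_atTop (a - k)] with n hn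
  exact image_mul_eq_of_eq ι (by omega) (by omega)

theorem limitPoint_ne_image (hι : Function.Injective ι)
    (hz : Tendsto (fun n : ℤ => ι ⟨n, n⟩) atTop (𝓝 z)) (k : ℤ) (x : ExtBicyclic) :
    limitPoint ι z k ≠ ι x := by
  obtain ⟨a, b⟩ := x
  intro h
  have h1 := limitPoint_mul_image hz (b + 1) (b + 1) k
  rw [h, add_sub_cancel_right, h, image_mul_image, image_inj hι] at h1
  omega

theorem limitPoint_mem_compl_upSet (hι : Function.Injective ι)
    (hz : Tendsto (fun n : ℤ => ι ⟨n, n⟩) atTop (𝓝 z)) (k : ℤ) :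
    limitPoint ι z k ∈ (upSet (Set.range ι))ᶜ := by
  rintro (⟨x, hx⟩ | ⟨-, _, ⟨⟨a, b⟩, rfl⟩, x, hx⟩)
  · exact limitPoint_ne_image hι hz k x hx.symm
  · rw [limitPoint_mul_image hz] at hx
    exact limitPoint_ne_image hι hz _ x hx.symm

/-- Right multiplication by (m, m) fixes (a, b) once b ≥ m, hence fixes x for every m. -/
theorem mul_limit_of_tendsto (hz : Tendsto (fun n : ℤ => ι ⟨n, n⟩) atTop (𝓝 z))
    {X : Type*} {F : Filter X} [F.NeBot] {a b : X → ℤ} {x : T}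
    (hx : Tendsto (fun i => ι ⟨a i, b i⟩) F (𝓝 x)) (hb : Tendsto b F atTop) :
    x * z = x := by
  have h (m : ℤ) : x * ι ⟨m, m⟩ = x := by
    refine tendsto_nhds_unique ((hx.mul_const _).congr' ?_) hx
    filter_upwards [hb.eventually_ge_atTop m] with i hi
    exact image_mul_eq_of_eq ι (by omega) (by omega)
  exact tendsto_nhds_unique (hz.const_mul x) (tendsto_const_nhds.congr fun m => (h m).symm)

theorem mem_closure_limitPoint_of_tendsto (hz : Tendsto (fun n : ℤ => ι ⟨n, n⟩) atTop (𝓝 z))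
    {X : Type*} {F : Filter X} [F.NeBot] {a b : X → ℤ} {x : T}
    (hx : Tendsto (fun i => ι ⟨a i, b i⟩) F (𝓝 x)) (hb : Tendsto b F atTop) :
    x ∈ closure (Set.range (limitPoint ι z)) := by
  rw [← mul_limit_of_tendsto hz hx hb]
  refine mem_closure_of_tendsto (hx.mul_const z) (Eventually.of_forall fun i => ?_)
  exact ⟨_, (image_mul_limit hz _ _).symm⟩

/-- The homomorphism `S₃ → T` that extends `ι` by the group at infinity. -/
def sThreeHom (hz : Tendsto (fun n : ℤ => ι ⟨n, n⟩) atTop (𝓝 z)) : SThree →ₙ* T where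
  toFun
    | .bic x => ι x
    | .grp k => limitPoint ι z k
  map_mul'
    | .bic x, .bic y => map_mul ι x y
    | .bic x, .grp k => (image_mul_limitPoint hz x.fst x.snd k).symm
    | .grp k, .bic x => (limitPoint_mul_image hz x.fst x.snd k).symm
    | .grp k, .grp l => (limitPoint_mul_limitPoint hz k l).symm

theorem continuous_sThreeHom (hz : Tendsto (fun n : ℤ => ι ⟨n, n⟩) atTop (𝓝 z)) :
    Continuous (sThreeHom hz) := by
  refine continuous_def.2 fun U hU k hk => ?_
  have hk' : limitPoint ι z k ∈ U := hk
  obtain ⟨N, hN⟩ := eventually_atTop.1 ((tendsto_limitPoint hz k).eventually_mem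
    (hU.mem_nhds hk'))
  refine ⟨max 1 N.toNat, le_max_left _ _, ?_⟩
  unfold SThree.basicNhd
  split_ifs with h0 <;> rintro _ (rfl | ⟨a, ha, rfl⟩)
  · exact hk
  · exact hN a (by omega)
  · exact hk
  · have := hN (a - k) (by omega)
    rwa [sub_add_cancel] at this

theorem limitPoint_inv (hz : Tendsto (fun n : ℤ => ι ⟨n, n⟩) atTop (𝓝 z)) (k : ℤ) :
    (limitPoint ι z k)⁻¹ = limitPoint ι z (-k) := by
  symm
  apply InverseSemigroup.inv_unique <;> simp [limitPoint_mul_limitPoint hz]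

variable [ContinuousInv T]

theorem mul_inv_of_mem_closure_limitPoint
    (hz : Tendsto (fun n : ℤ => ι ⟨n, n⟩) atTop (𝓝 z)) {x : T}
    (hx : x ∈ closure (Set.range (limitPoint ι z))) : x * x⁻¹ = z := by
  have hcl : IsClosed {x : T | x * x⁻¹ = z} := isClosed_eq (by fun_prop) continuous_const
  refine closure_minimal ?_ hcl hx
  rintro _ ⟨k, rfl⟩
  simp [limitPoint_inv hz, limitPoint_mul_limitPoint hz, limitPoint_zero hz]

/-- The group at infinity is not recurrent: this is where local compactness enters. -/
theorem eventually_limitPoint_notMem_atTop [LocallyCompactSpace T] (hι : Function.Injective ι)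
    (hz : Tendsto (fun n : ℤ => ι ⟨n, n⟩) atTop (𝓝 z)) :
    ∃ V ∈ 𝓝 z, ∀ᶠ k : ℤ in atTop, limitPoint ι z k ∉ V := by
  by_contra! hrec
  have hrec' : ∀ V ∈ 𝓝 z, ∀ M : ℤ, ∃ k ≥ M, limitPoint ι z k ∈ V := fun V hV => by
    have := hrec V hV
    rwa [frequently_atTop] at this
  obtain ⟨K, hK, hKz⟩ := exists_compact_mem_nhds z
  have hKz' : interior K ∈ 𝓝 z := interior_mem_nhds.2 hKz
  -- The last point of row n inside K; requiring k ≥ 0 makes the second coordinates tend to +∞.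
  have hmax : ∀ᶠ n : ℤ in atTop, ∃ k : ℤ, 0 ≤ k ∧ ι ⟨n, n + k⟩ ∈ K ∧
      ∀ l > k, ι ⟨n, n + l⟩ ∉ K := by
    obtain ⟨k₀, hk₀, hk₀K⟩ := hrec' _ hKz' 0
    filter_upwards [(tendsto_limitPoint hz k₀).eventually_mem
      (mem_interior_iff_mem_nhds.1 hk₀K)] with n hn
    obtain ⟨M, hM⟩ := eventually_atTop.1 (eventually_notMem_of_isCompact hι hK n)
    obtain ⟨k, ⟨hk0, hkK⟩, hk⟩ := Int.exists_greatest_of_bdd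
      (P := fun k => 0 ≤ k ∧ ι ⟨n, n + k⟩ ∈ K)
      ⟨M - n, fun k hk => not_lt.1 fun hlt => hM (n + k) (by omega) hk.2⟩ ⟨k₀, hk₀, hn⟩
    exact ⟨k, hk0, hkK, fun l hl hlK => not_lt.2 (hk l ⟨by omega, hlK⟩) hl⟩
  obtain ⟨k, hk⟩ := hmax.choice
  let U : Ultrafilter ℤ := Ultrafilter.of atTop
  have hU : (U : Filter ℤ) ≤ atTop := Ultrafilter.of_le _
  have hkU := hU hk
  obtain ⟨x, -, hx⟩ := hK.ultrafilter_le_nhds (U.map fun n => ι ⟨n, n + k n⟩)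
    (le_principal_iff.2 (Ultrafilter.mem_map.2 (mem_of_superset hkU fun n hn => hn.2.1)))
  have hx' : Tendsto (fun n => ι ⟨n, n + k n⟩) U (𝓝 x) := hx
  have hsnd : Tendsto (fun n => n + k n) U atTop :=
    tendsto_atTop_mono' _ (Eventually.mono hkU fun n hn => by simpa using hn.1) hU
  have hxz : x * z = x := mul_limit_of_tendsto hz hx' hsnd
  have hxcl := mem_closure_limitPoint_of_tendsto hz hx' hsnd
  -- Maximality passes to the limit: x g_p = x(0, p) is the limit of the points (n, n + k n + p),
  -- which lie outside K.
  have hout : ∀ p > 0, x * limitPoint ι z p ∉ interior K := by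
    intro p hp hmem
    have hxp : x * ι ⟨0, p⟩ ∈ interior K := by
      have h0 := limitPoint_mul_image hz 0 p 0
      rw [limitPoint_zero hz] at h0
      rw [← hxz, mul_assoc, h0]
      simpa using hmem
    have hev := (hx'.mul_const (ι ⟨0, p⟩)).eventually_mem (mem_interior_iff_mem_nhds.1 hxp)
    obtain ⟨n, ⟨hnK, hn⟩, hn0⟩ := ((hev.and hkU).and (hU (eventually_ge_atTop 0))).exists
    apply hn.2.2 (k n + p) (by omega)
    convert hnK using 1
    exact (image_mul_eq_of_eq ι (by omega) (by omega)).symm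
  -- Some g_k is so close to x that x g_k⁻¹ is close to x x⁻¹ = z. Recurrence then supplies p > k
  -- with x g_{p-k} still in the interior, against `hout`.
  have hfirst : ∃ k : ℤ, x * limitPoint ι z (-k) ∈ interior K := by
    have hopen : (fun y : T => x * y⁻¹) ⁻¹' interior K ∈ 𝓝 x := by
      refine (show Continuous fun y : T => x * y⁻¹ by fun_prop).continuousAt ?_
      rwa [mul_inv_of_mem_closure_limitPoint hz hxcl]
    obtain ⟨_, hy, k, rfl⟩ := mem_closure_iff_nhds.1 hxcl _ hopen
    exact ⟨k, by simpa only [Set.mem_preimage, limitPoint_inv hz] using hy⟩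
  obtain ⟨k, hk⟩ := hfirst
  have hopen : (fun y : T => x * limitPoint ι z (-k) * y) ⁻¹' interior K ∈ 𝓝 z := by
    refine (show Continuous fun y : T => x * limitPoint ι z (-k) * y by fun_prop).continuousAt ?_
    rw [mul_assoc]
    nth_rewrite 2 [← limitPoint_zero hz]
    rw [limitPoint_mul_limitPoint hz, add_zero]
    exact isOpen_interior.mem_nhds hk
  obtain ⟨p, hp, hpK⟩ := hrec' _ hopen (k + 1)
  refine hout (-k + p) (by omega) ?_
  rwa [Set.mem_preimage, mul_assoc, limitPoint_mul_limitPoint hz] at hpK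

theorem eventually_limitPoint_notMem_atBot [LocallyCompactSpace T] (hι : Function.Injective ι)
    (hz : Tendsto (fun n : ℤ => ι ⟨n, n⟩) atTop (𝓝 z)) :
    ∃ V ∈ 𝓝 z, ∀ᶠ k : ℤ in atBot, limitPoint ι z k ∉ V := by
  obtain ⟨V, hV, hVk⟩ := eventually_limitPoint_notMem_atTop hι hz
  have hzinv : z⁻¹ = z := by
    simpa [limitPoint_zero hz] using limitPoint_inv hz 0
  refine ⟨(fun x => x⁻¹) ⁻¹' V, continuous_inv.continuousAt (by rwa [hzinv]), ?_⟩
  filter_upwards [tendsto_neg_atBot_atTop.eventually hVk] with k hk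
  rwa [Set.mem_preimage, limitPoint_inv hz]

theorem limitPoint_injective [LocallyCompactSpace T] (hι : Function.Injective ι)
    (hz : Tendsto (fun n : ℤ => ι ⟨n, n⟩) atTop (𝓝 z)) :
    Function.Injective (limitPoint ι z) := by
  obtain ⟨V, hV, hVk⟩ := eventually_limitPoint_notMem_atTop hι hz
  -- A period d would make g_{nd} = z for all n, contradicting non-recurrence.
  have key : ∀ d > 0, limitPoint ι z d ≠ z := by
    intro d hd h
    have hmul (n : ℕ) : limitPoint ι z (n * d) = z := by
      induction n with
      | zero => simpa using limitPoint_zero hz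
      | succ n ih =>
        rw [Nat.cast_succ, add_mul, one_mul, ← limitPoint_mul_limitPoint hz, ih, h]
        exact mul_limit_limit hz
    have ht : Tendsto (fun n : ℕ => (n : ℤ) * d) atTop atTop :=
      tendsto_natCast_atTop_atTop.atTop_mul_const' hd
    obtain ⟨n, hn⟩ := (ht.eventually hVk).exists
    exact hn (by rw [hmul n]; exact mem_of_mem_nhds hV)
  have main : ∀ k l, k < l → limitPoint ι z k ≠ limitPoint ι z l := by
    intro k l hkl h
    apply key (l - k) (by omega)
    have := congrArg (· * limitPoint ι z (-k)) h
    simp only [limitPoint_mul_limitPoint hz] at this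
    rw [sub_eq_add_neg, ← this, add_neg_cancel, limitPoint_zero hz]
  intro k l h
  rcases lt_trichotomy k l with hlt | heq | hlt
  · exact (main _ _ hlt h).elim
  · exact heq
  · exact (main _ _ hlt h.symm).elim

theorem exists_nhds_forall_limitPoint_mem [LocallyCompactSpace T] (hι : Function.Injective ι)
    (hz : Tendsto (fun n : ℤ => ι ⟨n, n⟩) atTop (𝓝 z)) :
    ∃ V ∈ 𝓝 z, ∀ k : ℤ, limitPoint ι z k ∈ V → k = 0 := by
  obtain ⟨V, hV, hVk⟩ := eventually_limitPoint_notMem_atTop hι hz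
  obtain ⟨W, hW, hWk⟩ := eventually_limitPoint_notMem_atBot hι hz
  obtain ⟨M, hM⟩ := eventually_atTop.1 hVk
  obtain ⟨N, hN⟩ := eventually_atBot.1 hWk
  let A : Set T := limitPoint ι z '' (Set.Icc N M \ {0})
  have hA : IsClosed A := ((Set.finite_Icc N M).subset Set.sdiff_subset |>.image _).isClosed
  have hzA : z ∉ A := by
    rintro ⟨k, ⟨-, hk0⟩, hk⟩
    exact hk0 (limitPoint_injective hι hz (hk.trans (limitPoint_zero hz).symm))
  refine ⟨V ∩ W ∩ Aᶜ, inter_mem (inter_mem hV hW) (hA.isOpen_compl.mem_nhds hzA), ?_⟩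
  rintro k ⟨⟨hkV, hkW⟩, hkA⟩
  by_contra hk0
  refine hkA ⟨k, ⟨⟨?_, ?_⟩, hk0⟩, rfl⟩
  · exact not_lt.1 fun h => hN k h.le hkW
  · exact not_lt.1 fun h => hM k h.le hkV

theorem exists_isOpen_limitPoint_mem_iff [LocallyCompactSpace T] (hι : Function.Injective ι)
    (hz : Tendsto (fun n : ℤ => ι ⟨n, n⟩) atTop (𝓝 z)) (k : ℤ) :
    ∃ V : Set T, IsOpen V ∧ ∀ l : ℤ, limitPoint ι z l ∈ V ↔ l = k := by
  obtain ⟨V, hV, hVk⟩ := exists_nhds_forall_limitPoint_mem hι hz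
  refine ⟨(fun x => x * limitPoint ι z (-k)) ⁻¹' interior V,
    isOpen_interior.preimage (by fun_prop), fun l => ?_⟩
  rw [Set.mem_preimage, limitPoint_mul_limitPoint hz]
  constructor
  · intro h
    have := hVk _ (interior_subset h)
    omega
  · rintro rfl
    rw [add_neg_cancel, limitPoint_zero hz]
    exact mem_interior_iff_mem_nhds.2 hV

/-- As for discrete subgroups: since x x⁻¹ = z, a small neighbourhood W of x has W W⁻¹ inside a set
that isolates z, so W contains only one g_k. -/
theorem isClosed_range_limitPoint [LocallyCompactSpace T] (hι : Function.Injective ι)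
    (hz : Tendsto (fun n : ℤ => ι ⟨n, n⟩) atTop (𝓝 z)) :
    IsClosed (Set.range (limitPoint ι z)) := by
  refine isClosed_of_closure_subset fun x hx => ?_
  obtain ⟨V, hV, hVk⟩ := exists_nhds_forall_limitPoint_mem hι hz
  have hcont : Tendsto (fun p : T × T => p.1 * p.2⁻¹) (𝓝 x ×ˢ 𝓝 x) (𝓝 z) := by
    rw [← mul_inv_of_mem_closure_limitPoint hz hx, ← nhds_prod_eq]
    exact (show Continuous fun p : T × T => p.1 * p.2⁻¹ by fun_prop).tendsto (x, x)
  obtain ⟨W, hW, hWV⟩ := mem_prod_same_iff.1 (hcont hV)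
  obtain ⟨_, hkW, k, rfl⟩ := mem_closure_iff_nhds.1 hx W hW
  have hsub : Set.range (limitPoint ι z) ∩ W ⊆ {limitPoint ι z k} := by
    rintro _ ⟨⟨l, rfl⟩, hl⟩
    have h : limitPoint ι z l * (limitPoint ι z k)⁻¹ ∈ V :=
      hWV (Set.mk_mem_prod hl hkW)
    rw [limitPoint_inv hz, limitPoint_mul_limitPoint hz] at h
    have := hVk _ h
    rw [Set.mem_singleton_iff, show l = k by omega]
  have hxk : x ∈ closure ({limitPoint ι z k} : Set T) := by
    rw [mem_closure_iff_nhds]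
    intro t ht
    obtain ⟨y, ⟨hyt, hyW⟩, hyr⟩ := mem_closure_iff_nhds.1 hx _ (inter_mem ht hW)
    exact ⟨y, hyt, hsub ⟨hyr, hyW⟩⟩
  rw [closure_singleton] at hxk
  exact ⟨k, hxk.symm⟩

theorem range_limitPoint_eq [LocallyCompactSpace T] (hι : Function.Injective ι)
    (hdense : DenseRange ι) (hz : Tendsto (fun n : ℤ => ι ⟨n, n⟩) atTop (𝓝 z)) :
    Set.range (limitPoint ι z) = (upSet (Set.range ι))ᶜ := by
  refine Set.Subset.antisymm ?_ fun x hx => ?_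
  · rintro _ ⟨k, rfl⟩
    exact limitPoint_mem_compl_upSet hι hz k
  · obtain ⟨U, hU, hsnd⟩ := exists_ultrafilter_of_mem_compl_upSet hι hdense hx
    rw [← (isClosed_range_limitPoint hι hz).closure_eq]
    exact mem_closure_limitPoint_of_tendsto (F := (U : Filter ExtBicyclic)) hz hU hsnd

/-! ### The semilattice of idempotents below (n, n) -/

theorem idemDown_eq (hdense : DenseRange ι)
    (hz : Tendsto (fun n : ℤ => ι ⟨n, n⟩) atTop (𝓝 z)) (n : ℤ) :
    idemDown (ι ⟨n, n⟩) = insert z (Set.range fun j : ℕ => ι ⟨n + j, n + j⟩) ∧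
      IsCompact (idemDown (ι ⟨n, n⟩)) := by
  have hcomp : IsCompact (insert z (Set.range fun j : ℕ => ι ⟨n + j, n + j⟩)) :=
    (hz.comp (tendsto_atTop_add_const_left _ n
      tendsto_natCast_atTop_atTop)).isCompact_insert_range
  have heq : idemDown (ι ⟨n, n⟩) = insert z (Set.range fun j : ℕ => ι ⟨n + j, n + j⟩) := by
    refine Set.Subset.antisymm ?_ ?_
    · rintro f ⟨hf, hfn, -⟩
      -- This map sends (a, b) to (max a n, max a n) and fixes each idempotent below (n, n), so
      -- density suffices.
      have hcl : IsClosed ((fun x : T => x * x⁻¹ * ι ⟨n, n⟩) ⁻¹'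
          insert z (Set.range fun j : ℕ => ι ⟨n + j, n + j⟩)) :=
        hcomp.isClosed.preimage (by fun_prop)
      have hmem := closure_minimal ?_ hcl (hdense f)
      · rwa [Set.mem_preimage, hf.inv_eq, hf.eq, hfn] at hmem
      · rintro _ ⟨⟨a, b⟩, rfl⟩
        refine Or.inr ⟨(a - n).toNat, ?_⟩
        simp only [inv_image, image_mul_image]
        congr 2 <;> omega
    · rintro _ (rfl | ⟨j, rfl⟩)
      · exact ⟨mul_limit_limit hz, limit_idem_mul ι le_rfl hz n⟩
      · exact ⟨image_mul_eq_of_eq ι (by omega) (by omega),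
          image_mul_eq_of_eq ι (by omega) (by omega), image_mul_eq_of_eq ι (by omega) (by omega)⟩
  exact ⟨heq, heq ▸ hcomp⟩

theorem isSubsemilattice_idemDown (hdense : DenseRange ι)
    (hz : Tendsto (fun n : ℤ => ι ⟨n, n⟩) atTop (𝓝 z)) (n : ℤ) :
    IsSubsemilattice (idemDown (ι ⟨n, n⟩)) := by
  have hcomm : ∀ x ∈ idemDown (ι ⟨n, n⟩), ∀ y ∈ idemDown (ι ⟨n, n⟩), x * y = y * x := by
    rw [(idemDown_eq hdense hz n).1]
    rintro _ (rfl | ⟨i, rfl⟩) _ (rfl | ⟨j, rfl⟩)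
    · rfl
    · rw [(limit_idem_mul ι le_rfl hz _).1, (limit_idem_mul ι le_rfl hz _).2]
    · rw [(limit_idem_mul ι le_rfl hz _).1, (limit_idem_mul ι le_rfl hz _).2]
    · simp only [image_mul_image]
      congr 2 <;> omega
  refine ⟨⟨ι ⟨n, n⟩, ?_⟩, fun x hx y hy => ⟨?_, ?_, ?_⟩, hcomm, fun x hx => hx.1⟩
  · simp [idemDown, IsIdempotentElem, image_mul_image]
  · rw [IsIdempotentElem, mul_assoc, ← mul_assoc y, ← hcomm x hx y hy, mul_assoc x y, hy.1.eq,
      ← mul_assoc, hx.1.eq]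
  · rw [mul_assoc, hy.2.1]
  · rw [← mul_assoc, hx.2.2]

/-- The group at infinity as a homomorphic image of `ℤ`. -/
def limitHom (hz : Tendsto (fun n : ℤ => ι ⟨n, n⟩) atTop (𝓝 z)) : Multiplicative ℤ →ₙ* T where
  toFun k := limitPoint ι z k.toAdd
  map_mul' k l := (limitPoint_mul_limitPoint hz k.toAdd l.toAdd).symm

/-! ### Topological embeddings of ℤ and S₃ -/

theorem isEmbedding_limitHom [LocallyCompactSpace T] (hι : Function.Injective ι)
    (hz : Tendsto (fun n : ℤ => ι ⟨n, n⟩) atTop (𝓝 z)) : IsEmbedding (limitHom hz) := by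
  refine ⟨isInducing_iff_nhds.2 fun k => le_antisymm ?_ ?_,
    fun k l h => limitPoint_injective hι hz h⟩
  · exact continuous_of_discreteTopology.continuousAt.le_comap
  · obtain ⟨V, hV, hVk⟩ := exists_isOpen_limitPoint_mem_iff hι hz k.toAdd
    rw [nhds_discrete (Multiplicative ℤ), le_pure_iff]
    exact ⟨V, hV.mem_nhds ((hVk _).2 rfl), fun l hl => (hVk _).1 hl⟩

theorem sThreeHom_injective [LocallyCompactSpace T] (hι : Function.Injective ι)
    (hz : Tendsto (fun n : ℤ => ι ⟨n, n⟩) atTop (𝓝 z)) : Function.Injective (sThreeHom hz) := by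
  rintro (x | k) (y | l) h
  · exact congrArg SThree.bic (hι h)
  · exact (limitPoint_ne_image hι hz l x (Eq.symm h)).elim
  · exact (limitPoint_ne_image hι hz k y h).elim
  · exact congrArg SThree.grp (limitPoint_injective hι hz h)

theorem isEmbedding_sThreeHom [LocallyCompactSpace T] (hι : Function.Injective ι)
    (hdense : DenseRange ι) (hz : Tendsto (fun n : ℤ => ι ⟨n, n⟩) atTop (𝓝 z)) :
    IsEmbedding (sThreeHom hz) := by
  refine ⟨isInducing_iff_nhds.2 fun x => le_antisymm
    (continuous_sThreeHom hz).continuousAt.le_comap ?_, sThreeHom_injective hι hz⟩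
  rcases x with x | k
  · rw [isOpen_singleton_iff_nhds_eq_pure _ |>.1 (SThree.isOpen_singleton_bic x), le_pure_iff]
    refine ⟨{ι x}, (isOpen_singleton_image hι hdense x).mem_nhds rfl, fun y hy => ?_⟩
    exact sThreeHom_injective hι hz hy
  · refine (SThree.hasBasis_nhds_grp k).ge_iff.2 fun n _ => ?_
    obtain ⟨V, hV, hVk⟩ := exists_isOpen_limitPoint_mem_iff hι hz k
    -- On C the two conditions in `W` say b - a = k and a > N. The summand |k| is for k < 0, where
    -- U_n(k) bounds the second coordinate b = a - |k|.
    let N : ℤ := n + |k|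
    let W : Set T := {x | x * z ∈ V ∧ ι ⟨N, N⟩ * x ≠ ι ⟨N, N + k⟩}
    have hW : IsOpen W := (hV.preimage (continuous_mul_const z)).inter
      (isOpen_ne_fun (by fun_prop) (by fun_prop))
    have hkW : limitPoint ι z k ∈ W := by
      have h0 := limitPoint_mul_limitPoint hz k 0
      rw [limitPoint_zero hz, add_zero] at h0
      refine ⟨by rw [h0, hVk], ?_⟩
      rw [image_mul_limitPoint hz]
      exact limitPoint_ne_image hι hz _ _
    refine ⟨W, hW.mem_nhds hkW, ?_⟩
    rintro (⟨a, b⟩ | l) ⟨hxV, hxN⟩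
    · change ι ⟨a, b⟩ * z ∈ V at hxV
      change ι ⟨N, N⟩ * ι ⟨a, b⟩ ≠ _ at hxN
      rw [image_mul_limit hz, hVk] at hxV
      have ha : N < a := by
        by_contra! ha
        exact hxN (image_mul_eq_of_eq ι (by omega) (by omega))
      have hN : N = n + |k| := rfl
      unfold SThree.basicNhd
      split_ifs with h0
      · rw [abs_of_nonneg h0] at hN
        exact Or.inr ⟨a, by omega, by rw [show b = a + k by omega]⟩
      · rw [abs_of_neg (not_le.1 h0)] at hN
        exact Or.inr ⟨b, by omega, by rw [show a = b - k by omega]⟩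
    · change limitPoint ι z l * z ∈ V at hxV
      have h0 := limitPoint_mul_limitPoint hz l 0
      rw [limitPoint_zero hz, add_zero] at h0
      rw [h0, hVk] at hxV
      exact (SThree.grp_mem_basicNhd n k l).2 hxV

end GroupPart

end Embedding

/-- A surjective homomorphism from the extended bicyclic semigroup whose fibres are the sets
on which `b - a` is constant has the least group congruence as its kernel. -/
theorem ExtBicyclic.isLeast_ker {M : Type*} [Mul M] (h : ExtBicyclic →ₙ* M)
    (hh : ∀ x y : ExtBicyclic, h x = h y ↔ x.snd - x.fst = y.snd - y.fst) :
    IsLeast {c : Con ExtBicyclic | IsGroupCongruence c} (Con.ker h) := by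
  constructor
  · let d : ExtBicyclic → Multiplicative ℤ := fun x => .ofAdd (x.snd - x.fst)
    let F : (Con.ker h).Quotient → Multiplicative ℤ :=
      Quotient.lift d fun x y hxy => congrArg Multiplicative.ofAdd ((hh x y).1 hxy)
    have hF : Function.Bijective F := by
      constructor
      · rintro ⟨x⟩ ⟨y⟩ hxy
        exact Quotient.sound ((hh x y).2 hxy)
      · intro k
        exact ⟨((⟨0, k.toAdd⟩ : ExtBicyclic) : (Con.ker h).Quotient),
          congrArg Multiplicative.ofAdd (sub_zero _)⟩
    refine ⟨Multiplicative ℤ, inferInstance, ⟨⟨Equiv.ofBijective F hF, ?_⟩⟩⟩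
    rintro ⟨x⟩ ⟨y⟩
    refine congrArg Multiplicative.ofAdd (?_ : (x * y).snd - (x * y).fst =
      (x.snd - x.fst) + (y.snd - y.fst))
    rw [fst_mul, snd_mul]
    omega
  · rintro c ⟨G, hG, ⟨φ⟩⟩ ⟨a, b⟩ ⟨p, q⟩ hxy
    have hxy' : b - a = q - p := (hh _ _).1 hxy
    let π : ExtBicyclic → G := fun x => φ (x : c.Quotient)
    have hπ : ∀ x y, π (x * y) = π x * π y := fun x y => by
      simp only [π, Con.coe_mul, map_mul]
    -- A common idempotent multiplier merges two points of the same diagonal; it cancels in any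
    -- group quotient.
    have heq : (⟨max a p, max a p⟩ * ⟨a, b⟩ : ExtBicyclic) = ⟨max a p, max a p⟩ * ⟨p, q⟩ := by
      rw [mk_mul_mk, mk_mul_mk, ExtBicyclic.mk.injEq]
      omega
    have := congrArg π heq
    rw [hπ, hπ, mul_left_cancel_iff] at this
    exact c.eq.1 (φ.injective this)

/-! ### Assembly of the four assertions -/

theorem mainTheorem1 {T : Type*} [TopologicalSpace T] [T2Space T] [LocallyCompactSpace T]
    [InverseSemigroup T] [ContinuousMul T] [ContinuousInv T]
    (ι : ExtBicyclic →ₙ* T) (hι : Function.Injective ι) (hdense : DenseRange ι)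
    (hI : ((upSet (Set.range ι))ᶜ).Nonempty) :
    (∀ n : ℤ, IsCompact (idemDown (ι ⟨n, n⟩)) ∧ IsSubsemilattice (idemDown (ι ⟨n, n⟩))) ∧
    (∃ I : Subsemigroup T, (I : Set T) = (upSet (Set.range ι))ᶜ ∧
      Nonempty (I ≃ₜ* Multiplicative ℤ) ∧
      ∀ e : I, (∀ x : I, e * x = x ∧ x * e = x) →
        ∃ h : ExtBicyclic →ₙ* I,
          (∀ z : ExtBicyclic, (h z : T) = ι z * (e : T)) ∧
          Function.Surjective h ∧
          IsLeast {c : Con ExtBicyclic | IsGroupCongruence c} (Con.ker h)) ∧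
    (∃ S : Subsemigroup T, (S : Set T) = Set.range ι ∪ (upSet (Set.range ι))ᶜ ∧
      Nonempty (S ≃ₜ* SThree)) := by
  obtain ⟨z, hz⟩ := exists_tendsto_idem hι hdense hI
  have hrange := range_limitPoint_eq hι hdense hz
  refine ⟨fun n => ⟨(idemDown_eq hdense hz n).2, isSubsemilattice_idemDown hdense hz n⟩,
    ⟨(limitHom hz).srange, ?_,
      MulHom.nonempty_srange_continuousMulEquiv _ (isEmbedding_limitHom hι hz), ?_⟩,
    ⟨(sThreeHom hz).srange, ?_,
      MulHom.nonempty_srange_continuousMulEquiv _ (isEmbedding_sThreeHom hι hdense hz)⟩⟩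
  · rw [← hrange]
    rfl
  · intro e he
    have hez : (e : T) = z := by
      obtain ⟨_, k, rfl⟩ := e
      have h1 := congrArg Subtype.val (he ⟨_, Multiplicative.ofAdd 0, rfl⟩).1
      change limitPoint ι z k.toAdd * limitPoint ι z 0 = limitPoint ι z 0 at h1
      rw [limitPoint_mul_limitPoint hz, add_zero, limitPoint_zero hz] at h1
      exact h1
    have hval : ∀ x : ExtBicyclic, ι x * (e : T) = limitPoint ι z (x.snd - x.fst) := fun x => by
      rw [hez, ← image_mul_limit hz]
    let h : ExtBicyclic →ₙ* (limitHom hz).srange :=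
      { toFun := fun x => ⟨ι x * (e : T), Multiplicative.ofAdd (x.snd - x.fst), (hval x).symm⟩
        map_mul' := fun x y => Subtype.ext <| by
          change ι (x * y) * (e : T) = ι x * (e : T) * (ι y * (e : T))
          rw [hval, hval, hval, limitPoint_mul_limitPoint hz, ExtBicyclic.fst_mul,
            ExtBicyclic.snd_mul]
          congr 1
          omega }
    refine ⟨h, fun x => rfl, ?_, ExtBicyclic.isLeast_ker h fun x y => ?_⟩
    · rintro ⟨_, k, rfl⟩
      refine ⟨⟨0, k.toAdd⟩, Subtype.ext ((hval _).trans ?_)⟩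
      rw [sub_zero]
      rfl
    · rw [Subtype.ext_iff]
      change ι x * (e : T) = ι y * (e : T) ↔ _
      rw [hval, hval, (limitPoint_injective hι hz).eq_iff]
  · rw [← hrange]
    ext x
    constructor
    · rintro ⟨y | k, rfl⟩
      · exact Or.inl ⟨y, rfl⟩
      · exact Or.inr ⟨k, rfl⟩
    · rintro (⟨y, rfl⟩ | ⟨k, rfl⟩)
      · exact ⟨.bic y, rfl⟩
      · exact ⟨.grp k, rfl⟩
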